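/- Let $d\ge 0$ and let $\mathcal X=(X,\{R_i\}_{i=0}^d)$ be a $d$-class symmetric association scheme: $X$ is a finite nonempty set, $R_0,\dots,R_d$ are nonempty subsets that partition $X\times X$, $R_0=\{(x,x)\mid x\in X\}$, each $R_i$ is symmetric, and there are integers $p^h_{ij}$ $(0\le h,i,j\le d)$ such that $p^h_{ij}=|\{z\in X\mid (x,z)\in R_i,\ (z,y)\in R_j\}|$ for every $(x,y)\in R_h$. Let $A_i$ be the adjacency matrix of $R_i$, that is, the real $X\times X$ matrix whose $(x,y)$-entry is $1$ if $(x,y)\in R_i$ and $0$ otherwise; $A_0=I$ is called trivial. Let $\{E_i\}_{i=0}^d$ be the primitive idempotents of $\mathcal X$, that is, a basis of $M=\mathrm{span}_{\mathbb R}\{A_0,\dots,A_d\}$ such that $E_0=|X|^{-1}J$ (where $J$ is the all-ones matrix), $\sum_{i=0}^d E_i=I$, $E_i^t=E_i$ and $E_iE_j=\delta_{i,j}E_i$ for $0\le i,j\le d$. Define $P$ and $Q$ in $\mathrm{Mat}_{d+1}(\mathbb R)$ by $A_j=\sum_{i=0}^d P_{ij}E_i$ and $E_j=|X|^{-1}\sum_{i=0}^d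 Q_{ij}A_i$ for $0\le j\le d$; $P_{ij}$ is the eigenvalue of $A_j$ for $E_i$, and $Q_{ij}$ is the dual eigenvalue of $E_j$ for $A_i$. Let $B=A_b$ and $C=A_c$ be adjacency matrices of $\mathcal X$ with $B$ nontrivial ($b\neq 0$), and for $0\le i\le d$ let $\theta_i=P_{ib}$ be the eigenvalue of $B$ for $E_i$. Then the following are equivalent. (i) $\mathcal X$ is $P$-polynomial relative to $B$, and $C$ is the last adjacency matrix in this $P$-polynomial structure; that is, there is a permutation $\sigma$ of $\{0,\dots,d\}$ with $\sigma(0)=0$, $\sigma(1)=b$ and $\sigma(d)=c$ such that, for $0\le i,j\le d$, the intersection number $p^{\sigma(1)}_{\sigma(i)\,\sigma(j)}$ is zero if $|i-j|>1$ and nonzero if $|i-j|=1$. (ii) $\theta_0,\dots,\theta_d$ are mutually distinct, and for $0\le i\le d$ the dual eigenvalue $Q_{ci}$ of $E_i$ for $C$ is $$Q_{ci}=\frac{\prod_{0\le j\le d,\ j\ne 0}(\theta_0-\theta_j)}{\prod_{0\le j\le d,\ j\neq i}(\theta_i-\theta_j)}.$$ -/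

import Mathlib

/-- A `d`-class symmetric association scheme on a finite set `X`. The intersection numbers `p h i j`
(written `p^h_{ij}`) are uniquely determined by the relations, since every `R h` is nonempty;
nonemptiness of `X` follows from nonemptiness of `R 0`. -/
structure SymmetricAssociationScheme (X : Type*) [Fintype X] (d : ℕ) where
  R : Fin (d + 1) → Set (X × X)
  R_nonempty : ∀ i, (R i).Nonempty
  R_zero : R 0 = {q | q.1 = q.2}
  R_cover : ⋃ i, R i = Set.univ
  R_disjoint : ∀ i j, i ≠ j → Disjoint (R i) (R j)
  R_symm : ∀ i, {q : X × X | (q.2, q.1) ∈ R i} = R i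
  p : Fin (d + 1) → Fin (d + 1) → Fin (d + 1) → ℕ
  card_eq_p : ∀ h i j x y, (x, y) ∈ R h → {z : X | (x, z) ∈ R i ∧ (z, y) ∈ R j}.ncard = p h i j

namespace SymmetricAssociationScheme

variable {X : Type*} [Fintype X] {d : ℕ}

open Classical in
/-- The adjacency matrix `A_i`; the trivial one is `A_0 = I`. -/
noncomputable def adjacency (S : SymmetricAssociationScheme X d) (i : Fin (d + 1)) :
    Matrix X X ℝ :=
  Matrix.of fun x y => if (x, y) ∈ S.R i then 1 else 0

theorem linearIndependent_adjacency (S : SymmetricAssociationScheme X d) :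
    LinearIndependent ℝ S.adjacency := by
  classical
  rw [Fintype.linearIndependent_iff]
  intro g hg i
  obtain ⟨⟨x, y⟩, hxy⟩ := S.R_nonempty i
  have h := congrFun (congrFun hg x) y
  rw [Matrix.sum_apply, Finset.sum_eq_single i] at h
  · simpa [adjacency, hxy] using h
  · intro j _ hj
    have : (x, y) ∉ S.R j := fun hj' => Set.disjoint_left.1 (S.R_disjoint j i hj) hj' hxy
    simp [adjacency, this]
  · simp

/-- The Bose-Mesner algebra `M`, the linear span of the adjacency matrices. Its product is
the product of the ambient matrix algebra. -/
def boseMesner (S : SymmetricAssociationScheme X d) : Submodule ℝ (Matrix X X ℝ) :=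
  Submodule.span ℝ (Set.range S.adjacency)

/-- The basis `A_0, …, A_d` of the Bose-Mesner algebra. -/
noncomputable def adjacencyBasis (S : SymmetricAssociationScheme X d) :
    Module.Basis (Fin (d + 1)) ℝ S.boseMesner :=
  Module.Basis.span S.linearIndependent_adjacency

theorem adjacencyBasis_apply (S : SymmetricAssociationScheme X d) (i : Fin (d + 1)) :
    (S.adjacencyBasis i : Matrix X X ℝ) = S.adjacency i :=
  congrArg Subtype.val (Module.Basis.span_apply S.linearIndependent_adjacency i)

/-- The primitive idempotents `E_0, …, E_d`: a basis of the Bose-Mesner algebra consisting of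
symmetric, mutually orthogonal idempotents with sum `I` and with `E_0 = |X|⁻¹ J`, where `J` is the
all-ones matrix. This determines the `E_i` up to the ordering of `E_1, …, E_d`. -/
structure PrimitiveIdempotents [DecidableEq X] (S : SymmetricAssociationScheme X d) where
  basis : Module.Basis (Fin (d + 1)) ℝ S.boseMesner
  basis_zero : (basis 0 : Matrix X X ℝ) = (Fintype.card X : ℝ)⁻¹ • Matrix.of fun _ _ => 1
  sum_basis : ∑ i, (basis i : Matrix X X ℝ) = 1
  transpose_basis : ∀ i, (basis i : Matrix X X ℝ).transpose = basis i
  basis_mul_basis : ∀ i j,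
    (basis i : Matrix X X ℝ) * (basis j : Matrix X X ℝ) = if i = j then (basis i).1 else 0

namespace PrimitiveIdempotents

variable [DecidableEq X] {S : SymmetricAssociationScheme X d}

/-- The matrix `P`: the entry `P i j` is the eigenvalue of `A_j` for `E_i`. -/
noncomputable def P (E : S.PrimitiveIdempotents) : Matrix (Fin (d + 1)) (Fin (d + 1)) ℝ :=
  E.basis.toMatrix S.adjacencyBasis

/-- The matrix `Q`: the entry `Q i j` is the dual eigenvalue of `E_j` for `A_i`. -/
noncomputable def Q (E : S.PrimitiveIdempotents) : Matrix (Fin (d + 1)) (Fin (d + 1)) ℝ :=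
  (Fintype.card X : ℝ) • S.adjacencyBasis.toMatrix E.basis

/-- The defining equation of `P`. -/
theorem adjacency_eq_sum (E : S.PrimitiveIdempotents) (j : Fin (d + 1)) :
    S.adjacency j = ∑ i, E.P i j • (E.basis i : Matrix X X ℝ) := by
  have h := congrArg Subtype.val (E.basis.sum_toMatrix_smul_self S.adjacencyBasis j)
  rw [adjacencyBasis_apply, Submodule.coe_sum] at h
  rw [← h]
  rfl

/-- The defining equation of `Q`. -/
theorem basis_eq_sum (E : S.PrimitiveIdempotents) (j : Fin (d + 1)) :
    (E.basis j : Matrix X X ℝ) =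
      (Fintype.card X : ℝ)⁻¹ • ∑ i, E.Q i j • S.adjacency i := by
  obtain ⟨⟨x, _⟩, _⟩ := S.R_nonempty 0
  have : Nonempty X := ⟨x⟩
  have hX : (Fintype.card X : ℝ) ≠ 0 := by exact_mod_cast Fintype.card_ne_zero
  have h := congrArg Subtype.val (S.adjacencyBasis.sum_toMatrix_smul_self E.basis j)
  rw [Submodule.coe_sum] at h
  rw [← h, Finset.smul_sum]
  refine Finset.sum_congr rfl fun i _ => ?_
  rw [Submodule.coe_smul, adjacencyBasis_apply, smul_smul, Q, Matrix.smul_apply, smul_eq_mul,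
    inv_mul_cancel_left₀ hX]

end PrimitiveIdempotents

/-- The ordering `A_{σ 1}, …, A_{σ d}` of the nontrivial adjacency matrices (with `A_{σ 0} = A_0`)
is `P`-polynomial. -/
def IsPPolynomialOrdering (S : SymmetricAssociationScheme X d)
    (σ : Equiv.Perm (Fin (d + 1))) : Prop :=
  σ 0 = 0 ∧ ∀ i j : Fin (d + 1),
    (1 < |(i : ℤ) - (j : ℤ)| → S.p (σ 1) (σ i) (σ j) = 0) ∧
    (|(i : ℤ) - (j : ℤ)| = 1 → S.p (σ 1) (σ i) (σ j) ≠ 0)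

/-- The scheme is `P`-polynomial relative to `A_b`, and `A_c` is the last adjacency matrix in this
`P`-polynomial structure. -/
def IsPPolynomialWithLast (S : SymmetricAssociationScheme X d) (b c : Fin (d + 1)) : Prop :=
  ∃ σ : Equiv.Perm (Fin (d + 1)), S.IsPPolynomialOrdering σ ∧ σ 1 = b ∧ σ (Fin.last d) = c

end SymmetricAssociationScheme

/-! ### Relations and intersection numbers. -/

namespace SymmetricAssociationScheme

variable {X : Type*} [Fintype X] {d : ℕ}

/-! For `(x, y) ∈ R h`, the entry of `B ^ k` at `(x, y)` is `|X|⁻¹ ∑ i, θ i ^ k * Q h i`, and it is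
nonzero exactly when a walk of length `k` joins `x` to `y`. So the distance attached to `R h` is the
first nonvanishing moment of row `h` of `Q` at the nodes `θ i` (`reaches_iff_of_mem`). (i) ⇒ (ii):
`R c` is at distance at least `d`, so its moments below the `d`-th vanish. On distinct nodes this
forces the barycentric weights up to a scalar, which `Q c 0 = 1` determines. (ii) ⇒ (i): barycentric
weights have vanishing moments below the `d`-th and a nonzero `d`-th one, so `R c` is at distance
`d`. Then each distance `0, …, d` is taken by exactly one of the `d + 1` relations, and ordering by
distance is `P`-polynomial. -/

theorem exists_mem_R (S : SymmetricAssociationScheme X d) (x y : X) : ∃ i, (x, y) ∈ S.R i := by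
  have h : (x, y) ∈ ⋃ i, S.R i := by rw [S.R_cover]; trivial
  simpa using h

theorem eq_of_mem_R (S : SymmetricAssociationScheme X d) {i j : Fin (d + 1)} {x y : X}
    (hi : (x, y) ∈ S.R i) (hj : (x, y) ∈ S.R j) : i = j := by
  by_contra h
  exact Set.disjoint_left.1 (S.R_disjoint i j h) hi hj

theorem mem_R_swap (S : SymmetricAssociationScheme X d) {i : Fin (d + 1)} {x y : X}
    (h : (x, y) ∈ S.R i) : (y, x) ∈ S.R i := by
  rw [← S.R_symm i]
  exact h

theorem p_ne_zero_iff (S : SymmetricAssociationScheme X d) (h i j : Fin (d + 1)) :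
    S.p h i j ≠ 0 ↔ ∃ x y z, (x, y) ∈ S.R h ∧ (x, z) ∈ S.R i ∧ (z, y) ∈ S.R j := by
  constructor
  · intro hp
    obtain ⟨⟨x, y⟩, hxy⟩ := S.R_nonempty h
    rw [← S.card_eq_p h i j x y hxy] at hp
    obtain ⟨z, hz⟩ := Set.nonempty_of_ncard_ne_zero hp
    exact ⟨x, y, z, hxy, hz⟩
  · rintro ⟨x, y, z, hxy, hz⟩
    rw [← S.card_eq_p h i j x y hxy]
    exact Set.ncard_ne_zero_of_mem (s := {z : X | (x, z) ∈ S.R i ∧ (z, y) ∈ S.R j}) hz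

theorem p_comm (S : SymmetricAssociationScheme X d) {h i j : Fin (d + 1)}
    (hp : S.p h i j ≠ 0) : S.p h j i ≠ 0 := by
  rw [p_ne_zero_iff] at hp ⊢
  obtain ⟨x, y, z, hxy, hxz, hzy⟩ := hp
  exact ⟨y, x, z, S.mem_R_swap hxy, S.mem_R_swap hzy, S.mem_R_swap hxz⟩

theorem adjacency_apply_of_mem (S : SymmetricAssociationScheme X d) {h : Fin (d + 1)} {x y : X}
    (hxy : (x, y) ∈ S.R h) (i : Fin (d + 1)) : S.adjacency i x y = if i = h then 1 else 0 := by
  by_cases hi : i = h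
  · subst hi; simp [adjacency, hxy]
  · have : (x, y) ∉ S.R i := fun h' => hi (S.eq_of_mem_R h' hxy)
    simp [adjacency, this, hi]

theorem card_ne_zero (S : SymmetricAssociationScheme X d) : (Fintype.card X : ℝ) ≠ 0 := by
  obtain ⟨⟨x, _⟩, _⟩ := S.R_nonempty 0
  have : Nonempty X := ⟨x⟩
  exact_mod_cast Fintype.card_ne_zero

/-! ### Walks in the graph of `R b`. -/

variable [DecidableEq X]

/-- Rules out cancellation, so that a nonzero entry of a product yields a nonzero term, hence a
walk. -/
theorem adjacency_pow_nonneg (S : SymmetricAssociationScheme X d) (b : Fin (d + 1)) (k : ℕ)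
    (x y : X) : 0 ≤ (S.adjacency b ^ k) x y := by
  induction k generalizing y with
  | zero => rw [pow_zero, Matrix.one_apply]; split_ifs <;> norm_num
  | succ k ih =>
    rw [pow_succ, Matrix.mul_apply]
    refine Finset.sum_nonneg fun z _ => mul_nonneg (ih z) ?_
    simp only [adjacency, Matrix.of_apply]
    split_ifs <;> norm_num

/-- `y` can be reached from `x` by a walk of length `k` in the graph with edge set `R b`. -/
def Reaches (S : SymmetricAssociationScheme X d) (b : Fin (d + 1)) (k : ℕ) (x y : X) : Prop :=
  (S.adjacency b ^ k) x y ≠ 0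

theorem reaches_zero_iff (S : SymmetricAssociationScheme X d) (b : Fin (d + 1)) (x y : X) :
    S.Reaches b 0 x y ↔ (x, y) ∈ S.R 0 := by
  simp [Reaches, S.R_zero, Matrix.one_apply]

theorem reaches_succ_iff (S : SymmetricAssociationScheme X d) (b : Fin (d + 1)) (k : ℕ)
    (x y : X) : S.Reaches b (k + 1) x y ↔ ∃ z, S.Reaches b k x z ∧ (z, y) ∈ S.R b := by
  have hadj : ∀ z, S.adjacency b z y ≠ 0 ↔ (z, y) ∈ S.R b := by
    intro z; simp [adjacency]
  have hnn : ∀ z, 0 ≤ S.adjacency b z y := by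
    intro z; simpa using S.adjacency_pow_nonneg b 1 z y
  rw [Reaches, pow_succ, Matrix.mul_apply, Ne, Finset.sum_eq_zero_iff_of_nonneg
    fun z _ => mul_nonneg (S.adjacency_pow_nonneg b k x z) (hnn z)]
  simp only [Finset.mem_univ, true_imp_iff, not_forall, ← hadj, Reaches, mul_ne_zero_iff, ← ne_eq]

theorem reaches_one_iff (S : SymmetricAssociationScheme X d) (b : Fin (d + 1)) (x y : X) :
    S.Reaches b 1 x y ↔ (x, y) ∈ S.R b := by
  simp [Reaches, adjacency]

/-- In a `P`-polynomial ordering, points in relation `σ m` are at distance at least `m`. -/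
theorem IsPPolynomialOrdering.le_of_reaches {S : SymmetricAssociationScheme X d}
    {σ : Equiv.Perm (Fin (d + 1))} (hσ : S.IsPPolynomialOrdering σ) {k : ℕ} {x y : X}
    {m : Fin (d + 1)} (hm : (x, y) ∈ S.R (σ m)) (hk : S.Reaches (σ 1) k x y) : (m : ℕ) ≤ k := by
  induction k generalizing y m with
  | zero =>
    rw [reaches_zero_iff] at hk
    have h := S.eq_of_mem_R hm hk
    rw [← hσ.1] at h
    simp [σ.injective h]
  | succ k ih =>
    obtain ⟨z, hz, hzy⟩ := (S.reaches_succ_iff _ _ _ _).1 hk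
    obtain ⟨i, hi⟩ := S.exists_mem_R x z
    obtain ⟨n, rfl⟩ := σ.surjective i
    have hn := ih hi hz
    have hp : S.p (σ 1) (σ n) (σ m) ≠ 0 :=
      (S.p_ne_zero_iff _ _ _).2 ⟨z, y, x, hzy, S.mem_R_swap hi, hm⟩
    have h1 : ¬ 1 < |(n : ℤ) - (m : ℤ)| := fun h => hp ((hσ.2 n m).1 h)
    rw [not_lt, abs_le] at h1
    omega

/-- In a `P`-polynomial ordering, some pair in relation `σ m` is at distance at most `m`. -/
theorem IsPPolynomialOrdering.exists_reaches {S : SymmetricAssociationScheme X d}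
    {σ : Equiv.Perm (Fin (d + 1))} (hσ : S.IsPPolynomialOrdering σ)
    (hconst : ∀ (h : Fin (d + 1)) (k : ℕ) (x y x' y' : X), (x, y) ∈ S.R h → (x', y') ∈ S.R h →
      S.Reaches (σ 1) k x y → S.Reaches (σ 1) k x' y') (k : ℕ) (hk : k < d + 1) :
    ∃ x y, (x, y) ∈ S.R (σ ⟨k, hk⟩) ∧ S.Reaches (σ 1) k x y := by
  induction k with
  | zero =>
    obtain ⟨⟨x, y⟩, hxy⟩ := S.R_nonempty 0
    refine ⟨x, y, ?_, (S.reaches_zero_iff _ _ _).2 hxy⟩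
    rw [show (⟨0, hk⟩ : Fin (d + 1)) = 0 from rfl, hσ.1]
    exact hxy
  | succ k ih =>
    obtain ⟨x', y', hxy', hr⟩ := ih (by omega)
    have hp := (hσ.2 ⟨k, by omega⟩ ⟨k + 1, hk⟩).2 (by simp)
    obtain ⟨u, v, z, huv, huz, hzv⟩ := (S.p_ne_zero_iff _ _ _).1 hp
    -- `hconst` carries the walk from `(x', y')` to `(z, u)`, and the edge `(u, v)` extends it.
    exact ⟨z, v, hzv, (S.reaches_succ_iff _ _ _ _).2
      ⟨u, hconst _ _ _ _ _ _ hxy' (S.mem_R_swap huz) hr, huv⟩⟩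

/-! ### Walks as moments of the dual eigenvalues. -/

namespace PrimitiveIdempotents

variable {S : SymmetricAssociationScheme X d}

theorem basis_apply_of_mem (E : S.PrimitiveIdempotents) {h : Fin (d + 1)} {x y : X}
    (hxy : (x, y) ∈ S.R h) (i : Fin (d + 1)) :
    (E.basis i : Matrix X X ℝ) x y = (Fintype.card X : ℝ)⁻¹ * E.Q h i := by
  rw [E.basis_eq_sum, Matrix.smul_apply, Matrix.sum_apply]
  simp [S.adjacency_apply_of_mem hxy]

theorem Q_zero_right (E : S.PrimitiveIdempotents) (h : Fin (d + 1)) : E.Q h 0 = 1 := by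
  obtain ⟨⟨x, y⟩, hxy⟩ := S.R_nonempty h
  have h1 := E.basis_apply_of_mem hxy 0
  rw [E.basis_zero] at h1
  have hX := inv_ne_zero S.card_ne_zero
  simp only [Matrix.smul_apply, Matrix.of_apply, smul_eq_mul] at h1
  exact (mul_left_cancel₀ hX h1).symm

theorem adjacency_pow_eq_sum (E : S.PrimitiveIdempotents) (b : Fin (d + 1)) (k : ℕ) :
    S.adjacency b ^ k = ∑ i, E.P i b ^ k • (E.basis i : Matrix X X ℝ) := by
  induction k with
  | zero => simp [E.sum_basis]
  | succ k ih =>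
    rw [pow_succ, ih, E.adjacency_eq_sum b, Finset.sum_mul]
    refine Finset.sum_congr rfl fun i _ => ?_
    rw [Finset.mul_sum, Finset.sum_eq_single i]
    · rw [smul_mul_smul_comm, E.basis_mul_basis, if_pos rfl, pow_succ]
    · intro j _ hj
      rw [smul_mul_smul_comm, E.basis_mul_basis, if_neg hj.symm, smul_zero]
    · simp

theorem adjacency_pow_apply_of_mem (E : S.PrimitiveIdempotents) (b : Fin (d + 1)) (k : ℕ)
    {h : Fin (d + 1)} {x y : X} (hxy : (x, y) ∈ S.R h) :
    (S.adjacency b ^ k) x y = (Fintype.card X : ℝ)⁻¹ * ∑ i, E.P i b ^ k * E.Q h i := by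
  rw [E.adjacency_pow_eq_sum, Matrix.sum_apply, Finset.mul_sum]
  refine Finset.sum_congr rfl fun i _ => ?_
  rw [Matrix.smul_apply, E.basis_apply_of_mem hxy, smul_eq_mul]
  ring

theorem reaches_iff_of_mem (E : S.PrimitiveIdempotents) (b : Fin (d + 1)) (k : ℕ)
    {h : Fin (d + 1)} {x y : X} (hxy : (x, y) ∈ S.R h) :
    S.Reaches b k x y ↔ ∑ i, E.P i b ^ k * E.Q h i ≠ 0 := by
  rw [Reaches, E.adjacency_pow_apply_of_mem b k hxy]
  simp [S.card_ne_zero]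

theorem reaches_congr (E : S.PrimitiveIdempotents) {b : Fin (d + 1)} {k : ℕ}
    {h : Fin (d + 1)} {x y x' y' : X} (hxy : (x, y) ∈ S.R h) (hxy' : (x', y') ∈ S.R h)
    (hr : S.Reaches b k x y) : S.Reaches b k x' y' :=
  (E.reaches_iff_of_mem b k hxy').2 ((E.reaches_iff_of_mem b k hxy).1 hr)

/-- The moments of the rows of `Q`, ordered by `σ`, form a triangular matrix with nonzero diagonal.
It factors through the Vandermonde matrix of the eigenvalues, which is therefore invertible. -/
theorem injective_of_isPPolynomialOrdering (E : S.PrimitiveIdempotents)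
    {σ : Equiv.Perm (Fin (d + 1))} (hσ : S.IsPPolynomialOrdering σ) :
    Function.Injective fun i => E.P i (σ 1) := by
  rw [← Matrix.det_vandermonde_ne_zero_iff]
  set V := Matrix.vandermonde fun i => E.P i (σ 1) with hV
  let W : Matrix (Fin (d + 1)) (Fin (d + 1)) ℝ := Matrix.of fun i m => E.Q (σ m) i
  have hentry : ∀ k m, (V.transpose * W) k m = ∑ i, E.P i (σ 1) ^ (k : ℕ) * E.Q (σ m) i := by
    intro k m
    simp [Matrix.mul_apply, hV, W, Matrix.vandermonde_apply]
  have htri : (V.transpose * W).BlockTriangular OrderDual.toDual := by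
    intro k m hkm
    have hkm' : k < m := hkm
    rw [hentry]
    by_contra hne
    obtain ⟨⟨x, y⟩, hxy⟩ := S.R_nonempty (σ m)
    have := hσ.le_of_reaches hxy ((E.reaches_iff_of_mem _ _ hxy).2 hne)
    exact absurd this (not_le.2 hkm')
  have hdet : (V.transpose * W).det ≠ 0 := by
    rw [Matrix.det_of_isLowerTriangular _ htri, Finset.prod_ne_zero_iff]
    intro k _
    obtain ⟨x, y, hxy, hr⟩ := hσ.exists_reaches
      (fun _ _ _ _ _ _ h h' => E.reaches_congr h h') k k.2
    rw [hentry]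
    exact (E.reaches_iff_of_mem _ _ hxy).1 hr
  rw [Matrix.det_mul, Matrix.det_transpose] at hdet
  exact left_ne_zero_of_mul hdet

end PrimitiveIdempotents

end SymmetricAssociationScheme

/-! ### Barycentric weights. -/

/-- Weights on `n + 1` distinct nodes that annihilate all powers below the `n`-th are
proportional to the barycentric weights. -/
theorem eq_div_prod_of_forall_sum_pow_mul_eq_zero {K : Type*} [Field K] {n : ℕ}
    {v q : Fin (n + 1) → K} (hv : Function.Injective v)
    (hq : ∀ k < n, ∑ i, v i ^ k * q i = 0) (i : Fin (n + 1)) :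
    q i = (∑ j, v j ^ n * q j) / ∏ j ∈ Finset.univ.erase i, (v i - v j) := by
  classical
  have hvs : Set.InjOn v (Finset.univ : Finset (Fin (n + 1))) := hv.injOn
  -- Pairing `f` with `q` picks out `q i` by values, and the leading coefficient times the top
  -- moment by coefficients.
  set f := Lagrange.basis Finset.univ v i with hf
  have hdeg : f.natDegree = n := by
    rw [hf, Lagrange.natDegree_basis hvs (Finset.mem_univ i)]; simp
  have hlead : f.coeff n = (∏ j ∈ Finset.univ.erase i, (v i - v j))⁻¹ := by
    rw [← Lagrange.leadingCoeff_basis hvs (Finset.mem_univ i), Polynomial.leadingCoeff, ← hf, hdeg]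
  have h1 : ∑ j, f.eval (v j) * q j = q i := by
    rw [Finset.sum_eq_single i]
    · rw [hf, Lagrange.eval_basis_self hvs (Finset.mem_univ i), one_mul]
    · intro j _ hj
      rw [hf, Lagrange.eval_basis_of_ne hj.symm (Finset.mem_univ j), zero_mul]
    · simp
  have h2 : ∑ j, f.eval (v j) * q j
      = ∑ k ∈ Finset.range (n + 1), f.coeff k * ∑ j, v j ^ k * q j := by
    simp only [Polynomial.eval_eq_sum_range, hdeg, Finset.sum_mul, Finset.mul_sum]
    rw [Finset.sum_comm]
    simp only [mul_assoc]
  rw [← h1, h2, Finset.sum_range_succ, Finset.sum_eq_zero, zero_add, hlead, div_eq_inv_mul]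
  intro k hk
  rw [hq k (Finset.mem_range.1 hk), mul_zero]

/-- Up to the factor `a`, the sum is the degree `n` coefficient of the Lagrange interpolant of `X ^
k`, which is `X ^ k` itself. -/
theorem sum_pow_mul_div_prod {K : Type*} [Field K] {n : ℕ} {v : Fin (n + 1) → K}
    (hv : Function.Injective v) (a : K) {k : ℕ} (hk : k ≤ n) :
    ∑ i, v i ^ k * (a / ∏ j ∈ Finset.univ.erase i, (v i - v j)) = if k = n then a else 0 := by
  have h := Lagrange.coeff_eq_sum (s := Finset.univ) (v := v) hv.injOn
    (P := (Polynomial.X : Polynomial K) ^ k)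
    (by rw [Polynomial.degree_X_pow]; simp only [Finset.card_univ, Fintype.card_fin]
        exact_mod_cast Nat.lt_succ_of_le hk)
  simp only [Finset.card_univ, Fintype.card_fin, Polynomial.coeff_X_pow, Polynomial.eval_pow,
    Polynomial.eval_X, Nat.add_sub_cancel] at h
  calc _ = a * ∑ i, v i ^ k / ∏ j ∈ Finset.univ.erase i, (v i - v j) := by
        rw [Finset.mul_sum]; exact Finset.sum_congr rfl fun i _ => by ring
    _ = _ := by rw [← h]; simp [eq_comm]

/-! ### From a relation at distance `d` to a `P`-polynomial ordering. -/

namespace SymmetricAssociationScheme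

variable {X : Type*} [Fintype X] {d : ℕ} [DecidableEq X]

/-- The pairs in relation `h` are at distance exactly `k` in the graph with edge set `R b`. -/
def IsAtDistance (S : SymmetricAssociationScheme X d) (b h : Fin (d + 1)) (k : ℕ) : Prop :=
  ∀ x y, (x, y) ∈ S.R h → S.Reaches b k x y ∧ ∀ j < k, ¬ S.Reaches b j x y

theorem IsAtDistance.unique {S : SymmetricAssociationScheme X d} {b h : Fin (d + 1)} {k l : ℕ}
    (hk : S.IsAtDistance b h k) (hl : S.IsAtDistance b h l) : k = l := by
  obtain ⟨⟨x, y⟩, hxy⟩ := S.R_nonempty h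
  rcases lt_trichotomy k l with h' | h' | h'
  · exact absurd (hk x y hxy).1 ((hl x y hxy).2 k h')
  · exact h'
  · exact absurd (hl x y hxy).1 ((hk x y hxy).2 l h')

namespace PrimitiveIdempotents

variable {S : SymmetricAssociationScheme X d}

/-- Take the relation from the start of a shortest walk to its penultimate vertex. -/
theorem exists_isAtDistance_pred (E : S.PrimitiveIdempotents) {b h : Fin (d + 1)} {k : ℕ}
    (hh : S.IsAtDistance b h (k + 1)) :
    ∃ i, S.IsAtDistance b i k ∧ S.p b i h ≠ 0 := by
  obtain ⟨⟨x, y⟩, hxy⟩ := S.R_nonempty h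
  obtain ⟨hr, hmin⟩ := hh x y hxy
  obtain ⟨z, hz, hzy⟩ := (S.reaches_succ_iff _ _ _ _).1 hr
  obtain ⟨i, hi⟩ := S.exists_mem_R x z
  refine ⟨i, fun u v huv => ⟨E.reaches_congr hi huv hz, fun j hj hj' => ?_⟩,
    (S.p_ne_zero_iff _ _ _).2 ⟨z, y, x, hzy, S.mem_R_swap hi, hxy⟩⟩
  exact hmin (j + 1) (by omega)
    ((S.reaches_succ_iff _ _ _ _).2 ⟨z, E.reaches_congr huv hi hj', hzy⟩)

theorem exists_isAtDistance_of_le (E : S.PrimitiveIdempotents) {b h : Fin (d + 1)} {n k : ℕ}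
    (hh : S.IsAtDistance b h n) (hk : k ≤ n) : ∃ i, S.IsAtDistance b i k := by
  induction hk using Nat.decreasingInduction with
  | self => exact ⟨h, hh⟩
  | of_succ k _ ih =>
    obtain ⟨i, hi⟩ := ih
    obtain ⟨j, hj, _⟩ := E.exists_isAtDistance_pred hi
    exact ⟨j, hj⟩

theorem le_succ_of_p_ne_zero {b i j : Fin (d + 1)} {k l : ℕ}
    (hi : S.IsAtDistance b i k) (hj : S.IsAtDistance b j l) (hp : S.p b i j ≠ 0) : l ≤ k + 1 := by
  obtain ⟨x, y, z, hxy, hxz, hzy⟩ := (S.p_ne_zero_iff _ _ _).1 hp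
  by_contra h
  exact (hj z y hzy).2 (k + 1) (by omega)
    ((S.reaches_succ_iff _ _ _ _).2 ⟨x, (hi z x (S.mem_R_swap hxz)).1, hxy⟩)

/-- A scheme with `d` classes and a relation at distance `d` is `P`-polynomial. -/
theorem isPPolynomialWithLast_of_isAtDistance (E : S.PrimitiveIdempotents)
    {b c : Fin (d + 1)} (hb : b ≠ 0) (hc : S.IsAtDistance b c d) :
    S.IsPPolynomialWithLast b c := by
  have hd : 0 < d := by
    rcases Nat.eq_zero_or_pos d with rfl | h
    · exact absurd (Fin.ext (by omega)) hb
    · exact h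
  choose τ hτ using fun k : Fin (d + 1) => E.exists_isAtDistance_of_le hc (Nat.le_of_lt_succ k.2)
  -- A relation has only one distance, so by counting the `d + 1` distances exhaust the relations.
  have hinj : Function.Injective τ := fun k l hkl =>
    Fin.ext ((hτ k).unique (hkl ▸ hτ l))
  let σ : Equiv.Perm (Fin (d + 1)) := Equiv.ofBijective τ (Finite.injective_iff_bijective.1 hinj)
  have hσ : ∀ k, S.IsAtDistance b (σ k) k := hτ
  have heq : ∀ {h : Fin (d + 1)} {k : Fin (d + 1)}, S.IsAtDistance b h k → σ k = h := by
    intro h k hh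
    obtain ⟨l, rfl⟩ := σ.surjective h
    rw [Fin.ext (hh.unique (hσ l))]
  -- Needs `0 < d`: in `Fin 1` the numeral `1` is `0`.
  have hone : ((1 : Fin (d + 1)) : ℕ) = 1 := by
    rw [Fin.val_one', Nat.mod_eq_of_lt (by omega)]
  have h0 : σ 0 = 0 := by
    obtain ⟨⟨x, y⟩, hxy⟩ := S.R_nonempty (σ 0)
    exact S.eq_of_mem_R hxy ((S.reaches_zero_iff b x y).1 (hσ 0 x y hxy).1)
  have h1 : σ 1 = b := by
    obtain ⟨⟨x, y⟩, hxy⟩ := S.R_nonempty (σ 1)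
    have h := (hσ 1 x y hxy).1
    rw [hone] at h
    exact S.eq_of_mem_R hxy ((S.reaches_one_iff b x y).1 h)
  have hadj : ∀ i j : Fin (d + 1), (j : ℕ) = i + 1 → S.p b (σ i) (σ j) ≠ 0 := by
    intro i j hij
    have h := hσ j
    rw [hij] at h
    obtain ⟨l, hl, hp⟩ := E.exists_isAtDistance_pred h
    rwa [heq hl]
  refine ⟨σ, ⟨h0, fun i j => ⟨fun hij => ?_, fun hij => ?_⟩⟩, h1, heq hc⟩
  · rw [h1]
    by_contra hp
    have hji := le_succ_of_p_ne_zero (hσ i) (hσ j) hp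
    have hij' := le_succ_of_p_ne_zero (hσ j) (hσ i) (S.p_comm hp)
    rw [lt_abs] at hij
    omega
  · rw [h1]
    rcases (abs_eq (by norm_num)).1 hij with h | h
    · exact S.p_comm (hadj j i (by omega))
    · exact hadj i j (by omega)

end PrimitiveIdempotents

end SymmetricAssociationScheme

open SymmetricAssociationScheme PrimitiveIdempotents in
theorem theorem1p2 {X : Type*} [Fintype X] [DecidableEq X] {d : ℕ}
    (S : SymmetricAssociationScheme X d) (E : S.PrimitiveIdempotents)
    (b c : Fin (d + 1)) (hb : b ≠ 0)
    (θ : Fin (d + 1) → ℝ) (hθ : ∀ i, θ i = E.P i b) :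
    S.IsPPolynomialWithLast b c ↔
      (∀ i j, i ≠ j → θ i ≠ θ j) ∧
      ∀ i, E.Q c i =
        (∏ j ∈ Finset.univ.erase 0, (θ 0 - θ j)) /
          ∏ j ∈ Finset.univ.erase i, (θ i - θ j) := by
  obtain rfl : θ = fun i => E.P i b := funext hθ
  constructor
  · rintro ⟨σ, hσ, rfl, rfl⟩
    have hinj := E.injective_of_isPPolynomialOrdering hσ
    refine ⟨fun i j hij h => hij (hinj h), fun i => ?_⟩
    have hQ := eq_div_prod_of_forall_sum_pow_mul_eq_zero (q := E.Q (σ (Fin.last d))) hinj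
      fun k hk => by
        by_contra hne
        obtain ⟨⟨x, y⟩, hxy⟩ := S.R_nonempty (σ (Fin.last d))
        have h := hσ.le_of_reaches hxy ((E.reaches_iff_of_mem _ _ hxy).2 hne)
        rw [Fin.val_last] at h
        omega
    -- At `i = 0`, `Q c 0 = 1` identifies the unknown `d`-th moment with the numerator.
    have hQ0 := hQ 0
    rw [E.Q_zero_right, eq_comm, div_eq_one_iff_eq] at hQ0
    · rw [hQ i, hQ0]
    · refine Finset.prod_ne_zero_iff.2 fun j hj => sub_ne_zero.2 fun h => ?_
      exact (Finset.mem_erase.1 hj).1 (hinj h).symm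
  · rintro ⟨hne, hQ⟩
    have hinj : Function.Injective fun i => E.P i b :=
      fun i j h => by_contra fun hij => hne i j hij h
    refine E.isPPolynomialWithLast_of_isAtDistance hb fun x y hxy => ?_
    have hsum : ∀ k ≤ d, ∑ i, E.P i b ^ k * E.Q c i =
        if k = d then ∏ j ∈ Finset.univ.erase 0, (E.P 0 b - E.P j b) else 0 := by
      intro k hk
      simp only [hQ]
      exact sum_pow_mul_div_prod hinj _ hk
    refine ⟨?_, fun j hj => ?_⟩
    · rw [E.reaches_iff_of_mem b d hxy, hsum d le_rfl, if_pos rfl]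
      refine Finset.prod_ne_zero_iff.2 fun j hj => sub_ne_zero.2 fun h => ?_
      exact (Finset.mem_erase.1 hj).1 (hinj h).symm
    · rw [E.reaches_iff_of_mem b j hxy, hsum j hj.le, if_neg hj.ne]
      simp
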